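/- Let $\mathbb{F}$ be a field, let $a,b\in\mathbb{F}$, and let $\mathbb{H}=\mathbb{H}(a,b)$ be the quaternion algebra over $\mathbb{F}$ with basis $1,i,j,k$ and multiplication $i^2=a$, $j^2=b$, $ij=k$, $ji=-k$, with conjugation $\overline{x_0+x_1i+x_2j+x_3k}=x_0-x_1i-x_2j-x_3k$. Let $n\ge 1$. For an $n\times n$ matrix $A$ over $\mathbb{H}$ let $A^*$ be its conjugate transpose. For a permutation $\sigma\in S_n$ and an index $m$ whose cycle under $\sigma$ has length $l$, put $$A_\sigma(m)=a_{m,\sigma(m)}\,a_{\sigma(m),\sigma^2(m)}\cdots a_{\sigma^{l-1}(m),m}.$$ Given an index $p$, let $m_2<\dots<m_r$ be the smallest elements of the cycles of $\sigma$ (fixed points included) that do not contain $p$. The $p$-th row and column determinants of $A$ are $$\operatorname{rdet}_p A=\sum_{\sigma\in S_n}(-1)^{n-r}A_\sigma(p)\,A_\sigma(m_2)\cdots A_\sigma(m_r),\qquad \operatorname{cdet}_p A=\sum_{\sigma\in S_n}(-1)^{n-r}A_\sigma(m_r)\cdots A_\sigma(m_2)\,A_\sigma(p).$$ The double determinant of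 $A$ is $\operatorname{ddet}A=\det(AA^*):=\operatorname{rdet}_1(AA^*)$. For $1\le p,q\le n$, the left double $pq$-th cofactor $\mathbb{L}_{pq}$ of $A$ is $\operatorname{cdet}_q$ of the matrix obtained from $A^*A$ by replacing its $q$-th column with the $p$-th column of $A^*$, and the right double $pq$-th cofactor $\mathbb{R}_{pq}$ of $A$ is $\operatorname{rdet}_p$ of the matrix obtained from $AA^*$ by replacing its $p$-th row with the $q$-th row of $A^*$. If $\operatorname{ddet}A\neq 0$, then $\mathbb{L}_{pq}=\mathbb{R}_{pq}$ for all $p,q\in\{1,\dots,n\}$. -/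

import Mathlib

open scoped Quaternion Matrix

noncomputable section

namespace Matrix

variable {R : Type*} {n : ℕ}

/-- The ordered product along the cycle of `σ` through `k`, started at `k`:
`a_{k, σ k} * a_{σ k, σ² k} * ⋯ * a_{σ⁻¹ k, k}` (just `a_{k,k}` if `k` is a fixed point). -/
def cycleProd [Ring R] (A : Matrix (Fin n) (Fin n) R) (σ : Equiv.Perm (Fin n)) (k : Fin n) : R :=
  ((List.range (Function.minimalPeriod σ k)).map
    fun t => A ((σ ^ t) k) ((σ ^ (t + 1)) k)).prod

/-- The smallest elements of those cycles of `σ` (fixed points included) that do not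
contain `i`, listed in increasing order. -/
def otherCycleMins (σ : Equiv.Perm (Fin n)) (i : Fin n) : List (Fin n) :=
  (Finset.univ.filter fun m : Fin n =>
    ¬ σ.SameCycle i m ∧ ∀ l : Fin n, σ.SameCycle m l → m ≤ l).sort (· ≤ ·)

/-- The `i`-th row determinant. In the monomial of `σ` the cycle through `i` comes first and
starts at `i`; the other cycles follow, each started at its smallest element, in increasing order
of these smallest elements. The sign of `σ` is `(-1)^(n-r)`, with `r` the number of cycles of `σ`,
fixed points included. -/
def rdet [Ring R] (i : Fin n) (A : Matrix (Fin n) (Fin n) R) : R :=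
  ∑ σ : Equiv.Perm (Fin n), (Equiv.Perm.sign σ : ℤ) •
    (cycleProd A σ i * ((otherCycleMins σ i).map (cycleProd A σ)).prod)

/-- The `j`-th column determinant. In the monomial of `τ` the cycle through `j` stands last
(rightmost) and contributes `a_{j, τ j} * ⋯ * a_{τ⁻¹ j, j}`; to its left stand the other cycles,
in increasing order of their smallest elements when read from right to left, and the cycle with
smallest element `m` contributes `a_{m, τ m} * ⋯ * a_{τ⁻¹ m, m}`. -/
def cdet [Ring R] (j : Fin n) (A : Matrix (Fin n) (Fin n) R) : R :=
  ∑ τ : Equiv.Perm (Fin n), (Equiv.Perm.sign τ : ℤ) •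
    (((otherCycleMins τ j).reverse.map (cycleProd A τ)).prod * cycleProd A τ j)

/-- The determinant of a Hermitian matrix, as its first row determinant (for Hermitian matrices
over a quaternion algebra all row and column determinants agree). -/
def hermitianDet [Ring R] [NeZero n] (A : Matrix (Fin n) (Fin n) R) : R :=
  rdet 0 A

/-- The double determinant `ddet A = det (A A*)`. -/
def ddet [Ring R] [StarRing R] [NeZero n] (A : Matrix (Fin n) (Fin n) R) : R :=
  hermitianDet (A * Aᴴ)

/-- The left double `ij`-th cofactor: `cdet_j` of `A* A` with its `j`-th column replaced by the
`i`-th column of `A*`. -/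
def leftDoubleCofactor [Ring R] [StarRing R] (A : Matrix (Fin n) (Fin n) R) (i j : Fin n) : R :=
  cdet j ((Aᴴ * A).updateCol j (fun k => Aᴴ k i))

/-- The right double `ij`-th cofactor: `rdet_i` of `A A*` with its `i`-th row replaced by the
`j`-th row of `A*`. -/
def rightDoubleCofactor [Ring R] [StarRing R] (A : Matrix (Fin n) (Fin n) R) (i j : Fin n) : R :=
  rdet i ((A * Aᴴ).updateRow i (fun k => Aᴴ j k))

end Matrix

end

/-!
In a row determinant of a matrix that is Hermitian with scalar diagonal away from the `i`-th row,
the permutations can be grouped by reversing cycles that do not contain `i`. A reversal conjugates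
the cycle product, so the cycle products away from `i` may be replaced by their real parts. As real
parts are central and cyclically invariant, all row determinants of a Hermitian matrix `H` agree,
with common value its Moore determinant `d`, and `rdet i` vanishes when row `i` repeats another row.
Thus `H * rowAdjugate H = d • 1`.

Applied to `A * Aᴴ` and to `Aᴴ * A`, this exhibits the matrices of right and of left double
cofactors as `ddet A` times a right inverse of `A` and `ddet Aᴴ` times a left inverse of `A`.
Elementary matrices change the Moore determinants of `A * Aᴴ` and of `Aᴴ * A` by the same factor, so
the two cofactors agree for products of invertible elementary matrices. Gaussian elimination shows
that every matrix over a quaternion algebra over `R⟦X⟧` which reduces to the identity at `X = 0`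
is such a product, in particular the pencil `(1 - X) • 1 + X • A`. Both cofactors of this
pencil are polynomials in `X`, hence they agree at `X = 1` as well.
-/

namespace DoubleCofactor

open Matrix
open Equiv (Perm)

section Cycles

variable {α : Type*} {f g : Perm α} {x y : α}

lemma pow_apply_congr (h : ∀ y, f.SameCycle x y → g y = f y) (t : ℕ) : (g ^ t) x = (f ^ t) x := by
  induction t with
  | zero => rfl
  | succ t ih =>
    rw [pow_succ', pow_succ', Perm.mul_apply, Perm.mul_apply, ih]
    exact h _ (Perm.sameCycle_pow_right.2 .rfl)

lemma isPeriodicPt_iff_pow_apply_eq {t : ℕ} : Function.IsPeriodicPt f t x ↔ (f ^ t) x = x := by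
  rw [Function.IsPeriodicPt, Function.IsFixedPt, Perm.iterate_eq_pow]

lemma pow_minimalPeriod_apply (f : Perm α) (x : α) : (f ^ Function.minimalPeriod f x) x = x :=
  isPeriodicPt_iff_pow_apply_eq.1 (Function.isPeriodicPt_minimalPeriod f x)

lemma pow_apply_ne_of_lt_minimalPeriod {t : ℕ} (h0 : 0 < t) (ht : t < Function.minimalPeriod f x) :
    (f ^ t) x ≠ x := fun h =>
  Function.not_isPeriodicPt_of_pos_of_lt_minimalPeriod h0.ne' ht
    (isPeriodicPt_iff_pow_apply_eq.2 h)

lemma minimalPeriod_congr (h : ∀ y, f.SameCycle x y → g y = f y) :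
    Function.minimalPeriod g x = Function.minimalPeriod f x := by
  simp only [Function.minimalPeriod_eq_minimalPeriod_iff, isPeriodicPt_iff_pow_apply_eq,
    pow_apply_congr h, implies_true]

lemma minimalPeriod_inv (f : Perm α) (x : α) :
    Function.minimalPeriod ⇑f⁻¹ x = Function.minimalPeriod f x := by
  simp only [Function.minimalPeriod_eq_minimalPeriod_iff, isPeriodicPt_iff_pow_apply_eq, inv_pow,
    Perm.inv_eq_iff_eq]
  exact fun _ => eq_comm

lemma minimalPeriod_eq_of_forall_pow_apply_ne {p : ℕ} (h0 : 0 < p) (hp : (f ^ p) x = x)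
    (h : ∀ t, 0 < t → t < p → (f ^ t) x ≠ x) : Function.minimalPeriod f x = p := by
  have hper : Function.IsPeriodicPt f p x := isPeriodicPt_iff_pow_apply_eq.2 hp
  refine le_antisymm (hper.minimalPeriod_le h0) (not_lt.1 fun hlt => ?_)
  exact h _ (hper.minimalPeriod_pos h0) hlt (pow_minimalPeriod_apply f x)

section Finite

variable [Finite α]

lemma minimalPeriod_pos (f : Perm α) (x : α) : 0 < Function.minimalPeriod f x :=
  Function.minimalPeriod_pos_of_mem_periodicPts (f.injective.mem_periodicPts x)

lemma sameCycle_induction {p : α → Prop} (hp : ∀ z, p z → p (f z)) (hx : p x)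
    (h : f.SameCycle x y) : p y := by
  obtain ⟨t, rfl⟩ := h.exists_nat_pow_eq
  clear h
  induction t with
  | zero => exact hx
  | succ t ih => rw [pow_succ']; exact hp _ ih

lemma sameCycle_congr (h : ∀ y, f.SameCycle x y → g y = f y) :
    g.SameCycle x y ↔ f.SameCycle x y := by
  constructor <;> intro hy <;> obtain ⟨t, rfl⟩ := hy.exists_nat_pow_eq
  · rw [pow_apply_congr h, Perm.sameCycle_pow_right]
  · rw [← pow_apply_congr h, Perm.sameCycle_pow_right]

end Finite

section Flip

variable [DecidableEq α] [Fintype α] {m : α}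

/-- The permutation `f` with its cycle through `m` reversed. -/
def flipCycle (f : Perm α) (m : α) : Perm α := f * (f.cycleOf m)⁻¹ * (f.cycleOf m)⁻¹

lemma flipCycle_apply_of_sameCycle (h : f.SameCycle m x) : flipCycle f m x = f⁻¹ x := by
  have hx : (f⁻¹).SameCycle m x := Perm.sameCycle_inv.2 h
  rw [flipCycle, Perm.mul_apply, Perm.mul_apply, Perm.cycleOf_inv, hx.cycleOf_apply,
    (Perm.sameCycle_apply_right.2 hx).cycleOf_apply]
  exact f.apply_symm_apply _

lemma flipCycle_apply_of_not_sameCycle (h : ¬ f.SameCycle m x) : flipCycle f m x = f x := by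
  have hx : ¬ (f⁻¹).SameCycle m x := mt Perm.sameCycle_inv.1 h
  rw [flipCycle, Perm.mul_apply, Perm.mul_apply, Perm.cycleOf_inv,
    Perm.cycleOf_apply_of_not_sameCycle hx, Perm.cycleOf_apply_of_not_sameCycle hx]

lemma flipCycle_eq_on_other_cycle (hx : ¬ f.SameCycle m x) (y : α) (hy : f.SameCycle x y) :
    flipCycle f m y = f y :=
  flipCycle_apply_of_not_sameCycle fun h => hx (h.trans hy.symm)

lemma sign_flipCycle (f : Perm α) (m : α) : Perm.sign (flipCycle f m) = Perm.sign f := by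
  rw [flipCycle, Perm.sign_mul, Perm.sign_mul, mul_assoc, Int.units_mul_self, mul_one]

lemma sameCycle_flipCycle : (flipCycle f m).SameCycle x y ↔ f.SameCycle x y := by
  by_cases hx : f.SameCycle m x
  · rw [sameCycle_congr (f := f⁻¹), Perm.sameCycle_inv]
    exact fun y hy => flipCycle_apply_of_sameCycle (hx.trans (Perm.sameCycle_inv.1 hy))
  · exact sameCycle_congr (flipCycle_eq_on_other_cycle hx)

lemma flipCycle_flipCycle (f : Perm α) (m : α) : flipCycle (flipCycle f m) m = f := by
  ext x
  by_cases h : f.SameCycle m x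
  · rw [flipCycle_apply_of_sameCycle (sameCycle_flipCycle.2 h), Perm.inv_eq_iff_eq,
      flipCycle_apply_of_sameCycle (Perm.sameCycle_apply_right.2 h)]
    exact (f.symm_apply_apply x).symm
  · rw [flipCycle_apply_of_not_sameCycle (mt sameCycle_flipCycle.1 h),
      flipCycle_apply_of_not_sameCycle h]

end Flip

section MulSwap

variable [DecidableEq α] {σ : Perm α} {i k m : α}

lemma pow_mul_swap_apply (h : ¬ σ.SameCycle i k) {t : ℕ} (ht : t < Function.minimalPeriod σ k) :
    ((σ * Equiv.swap i k) ^ (t + 1)) i = (σ ^ (t + 1)) k := by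
  induction t with
  | zero => simp
  | succ t ih =>
    rw [pow_succ', Perm.mul_apply, ih (by lia), pow_succ' σ (t + 1), Perm.mul_apply,
      Perm.mul_apply, Equiv.swap_apply_of_ne_of_ne]
    · exact fun e => h (Perm.SameCycle.symm (e ▸ Perm.sameCycle_pow_right.2 .rfl))
    · exact pow_apply_ne_of_lt_minimalPeriod t.succ_pos ht

variable [Finite α]

lemma pow_minimalPeriod_mul_swap_apply (h : ¬ σ.SameCycle i k) :
    ((σ * Equiv.swap i k) ^ Function.minimalPeriod σ k) i = k := by
  have hk := minimalPeriod_pos σ k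
  have := pow_mul_swap_apply h (Nat.sub_one_lt hk.ne')
  rwa [Nat.sub_add_cancel hk, pow_minimalPeriod_apply] at this

lemma minimalPeriod_mul_swap (h : ¬ σ.SameCycle i k) :
    Function.minimalPeriod ⇑(σ * Equiv.swap i k) i =
      Function.minimalPeriod σ k + Function.minimalPeriod σ i := by
  have h' : ¬ σ.SameCycle k i := fun e => h e.symm
  have hk := pow_minimalPeriod_mul_swap_apply h
  have hi := pow_minimalPeriod_mul_swap_apply h'
  rw [Equiv.swap_comm] at hi
  refine minimalPeriod_eq_of_forall_pow_apply_ne (Nat.add_pos_left (minimalPeriod_pos σ k) _)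
    (by rw [add_comm, pow_add, Perm.mul_apply, hk, hi]) fun t h0 ht e => ?_
  rcases le_or_gt t (Function.minimalPeriod σ k) with htk | htk
  · obtain ⟨s, rfl⟩ := Nat.exists_eq_succ_of_ne_zero h0.ne'
    rw [Nat.succ_eq_add_one, pow_mul_swap_apply h (by lia)] at e
    exact h' (e ▸ Perm.sameCycle_pow_right.2 .rfl)
  · obtain ⟨s, rfl⟩ : ∃ s, t = s + 1 + Function.minimalPeriod σ k :=
      ⟨t - 1 - Function.minimalPeriod σ k, by lia⟩
    rw [pow_add, Perm.mul_apply, hk, Equiv.swap_comm, pow_mul_swap_apply h' (by lia)] at e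
    exact pow_apply_ne_of_lt_minimalPeriod s.succ_pos (by lia) e

lemma sameCycle_mul_swap_iff (h : ¬ σ.SameCycle i k) :
    (σ * Equiv.swap i k).SameCycle i m ↔ σ.SameCycle i m ∨ σ.SameCycle k m := by
  have hik : (σ * Equiv.swap i k).SameCycle i k :=
    ⟨Function.minimalPeriod σ k, by simpa using pow_minimalPeriod_mul_swap_apply h⟩
  constructor
  · refine sameCycle_induction (p := fun m => σ.SameCycle i m ∨ σ.SameCycle k m) (fun z hz => ?_)
      (Or.inl .rfl)
    simp only [Perm.mul_apply, Perm.sameCycle_apply_right]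
    by_cases hzi : z = i
    · rw [hzi, Equiv.swap_apply_left]; exact Or.inr .rfl
    by_cases hzk : z = k
    · rw [hzk, Equiv.swap_apply_right]; exact Or.inl .rfl
    rwa [Equiv.swap_apply_of_ne_of_ne hzi hzk]
  · have hσ : ∀ z, (σ * Equiv.swap i k).SameCycle i z → (σ * Equiv.swap i k).SameCycle i (σ z) := by
      intro z hz
      have hswap : σ z = (σ * Equiv.swap i k) (Equiv.swap i k z) := by simp
      rw [hswap, Perm.sameCycle_apply_right]
      by_cases hzi : z = i
      · rwa [hzi, Equiv.swap_apply_left]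
      by_cases hzk : z = k
      · rw [hzk, Equiv.swap_apply_right]
      rwa [Equiv.swap_apply_of_ne_of_ne hzi hzk]
    rintro (hm | hm)
    · exact sameCycle_induction (p := (σ * Equiv.swap i k).SameCycle i) hσ .rfl hm
    · exact sameCycle_induction (p := (σ * Equiv.swap i k).SameCycle i) hσ hik hm

lemma not_sameCycle_mul_swap (hik : i ≠ k) (h : σ.SameCycle i k) :
    ¬ (σ * Equiv.swap i k).SameCycle i k := by
  classical
  have hex : ∃ d : ℕ, (σ ^ d) k = i := h.symm.exists_nat_pow_eq
  set d := Nat.find hex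
  have hd : (σ ^ d) k = i := Nat.find_spec hex
  have hmin : ∀ r < d, (σ ^ r) k ≠ i := fun r hr => Nat.find_min hex hr
  have hd0 : 0 < d := Nat.pos_of_ne_zero fun h0 => hik (by rw [← hd, h0, pow_zero, Perm.one_apply])
  have hk : ∀ r, 0 < r → r ≤ d → (σ ^ r) k ≠ k := fun r h0 hr e =>
    hmin (d - r) (by lia) <| by
      rw [← hd, ← congrArg (σ ^ (d - r)) e, ← Perm.mul_apply, ← pow_add, Nat.sub_add_cancel hr]
  intro e
  obtain ⟨r, h0, hr, hrk⟩ : ∃ r, 0 < r ∧ r ≤ d ∧ (σ ^ r) k = k := by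
    refine sameCycle_induction (p := fun y => ∃ r, 0 < r ∧ r ≤ d ∧ (σ ^ r) k = y) ?_
      ⟨d, hd0, le_rfl, hd⟩ e
    rintro _ ⟨r, h0, hr, rfl⟩
    rcases hr.eq_or_lt with rfl | hr
    · exact ⟨1, one_pos, hd0, by rw [hd, Perm.mul_apply, Equiv.swap_apply_left, pow_one]⟩
    · refine ⟨r + 1, r.succ_pos, hr, ?_⟩
      rw [Perm.mul_apply, Equiv.swap_apply_of_ne_of_ne (hmin r hr) (hk r h0 hr.le), pow_succ',
        Perm.mul_apply]
  exact hk r h0 hr hrk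

end MulSwap

end Cycles

lemma sum_perm_eq_sum_not_sameCycle {α M : Type*} [DecidableEq α] [Fintype α] [AddCommMonoid M]
    {i k : α} (hik : i ≠ k) (f : Perm α → M) :
    ∑ σ, f σ = ∑ σ with ¬ σ.SameCycle i k, (f σ + f (σ * Equiv.swap i k)) := by
  rw [← Finset.sum_filter_not_add_sum_filter Finset.univ fun σ : Perm α => σ.SameCycle i k,
    Finset.sum_add_distrib]
  congr 1
  refine Finset.sum_nbij' (· * Equiv.swap i k) (· * Equiv.swap i k)
    (fun σ hσ => ?_) (fun σ hσ => ?_) ?_ ?_ ?_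
  · simp only [Finset.mem_filter, Finset.mem_univ, true_and] at hσ ⊢
    exact not_sameCycle_mul_swap hik hσ
  · simp only [Finset.mem_filter, Finset.mem_univ, true_and] at hσ ⊢
    exact (sameCycle_mul_swap_iff hσ).2 (Or.inr .rfl)
  all_goals simp [mul_assoc]

section WalkProd

variable {α S : Type*} [Ring S]

/-- The product of the entries of `A` along the first `t` steps of the orbit of `x` under `σ`;
a cycle product is the walk product over one full period. -/
def walkProd (A : Matrix α α S) (σ : Perm α) (x : α) (t : ℕ) : S :=
  ((List.range t).map fun s => A ((σ ^ s) x) ((σ ^ (s + 1)) x)).prod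

variable (A : Matrix α α S) (σ : Perm α) (x : α)

lemma walkProd_zero : walkProd A σ x 0 = 1 := rfl

lemma walkProd_succ (t : ℕ) :
    walkProd A σ x (t + 1) = walkProd A σ x t * A ((σ ^ t) x) ((σ ^ (t + 1)) x) :=
  List.prod_range_succ _ t

lemma walkProd_add (t s : ℕ) :
    walkProd A σ x (t + s) = walkProd A σ x t * walkProd A σ ((σ ^ t) x) s := by
  induction s with
  | zero => rw [add_zero, walkProd_zero, mul_one]
  | succ s ih =>
    rw [← add_assoc, walkProd_succ, ih, walkProd_succ, mul_assoc, ← Perm.mul_apply,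
      ← Perm.mul_apply, ← pow_add, ← pow_add, add_comm s t, add_right_comm s 1 t, add_comm s t]

lemma walkProd_succ' (t : ℕ) :
    walkProd A σ x (t + 1) = A x (σ x) * walkProd A σ (σ x) t := by
  rw [add_comm, walkProd_add, walkProd_succ, walkProd_zero, one_mul, zero_add, pow_one, pow_zero,
    Perm.one_apply]

lemma star_walkProd [StarRing S] (t : ℕ) :
    star (walkProd A σ x t) = walkProd Aᴴ σ⁻¹ ((σ ^ t) x) t := by
  induction t with
  | zero => rw [walkProd_zero, walkProd_zero, star_one]
  | succ t ih =>
    have hinv : σ⁻¹ ((σ ^ (t + 1)) x) = (σ ^ t) x := by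
      rw [Perm.inv_eq_iff_eq, pow_succ', Perm.mul_apply]
    rw [walkProd_succ, star_mul, ih, walkProd_succ', hinv, conjTranspose_apply]

lemma walkProd_congr {A B : Matrix α α S} {σ τ : Perm α} {x y : α} {t : ℕ}
    (h : ∀ s < t, B ((τ ^ s) y) ((τ ^ (s + 1)) y) = A ((σ ^ s) x) ((σ ^ (s + 1)) x)) :
    walkProd B τ y t = walkProd A σ x t :=
  congrArg List.prod (List.map_congr_left fun s hs => h s (List.mem_range.1 hs))

end WalkProd

section CycleProd

variable {n : ℕ} {S : Type*} [Ring S]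

variable (A : Matrix (Fin n) (Fin n) S) (σ : Perm (Fin n)) (x : Fin n)

lemma cycleProd_eq_walkProd : cycleProd A σ x = walkProd A σ x (Function.minimalPeriod σ x) := rfl

lemma cycleProd_eq_mul_walkProd :
    cycleProd A σ x = A x (σ x) * walkProd A σ (σ x) (Function.minimalPeriod σ x - 1) := by
  rw [cycleProd_eq_walkProd, ← walkProd_succ', Nat.sub_add_cancel (minimalPeriod_pos σ x)]

lemma cycleProd_apply_eq_walkProd_mul :
    cycleProd A σ (σ x) = walkProd A σ (σ x) (Function.minimalPeriod σ x - 1) * A x (σ x) := by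
  obtain ⟨p, hp⟩ := Nat.exists_eq_succ_of_ne_zero (minimalPeriod_pos σ x).ne'
  have hx : (σ ^ p) (σ x) = x := by
    rw [← Perm.mul_apply, ← pow_succ, ← Nat.succ_eq_add_one, ← hp, pow_minimalPeriod_apply]
  rw [cycleProd_eq_walkProd,
    Function.minimalPeriod_apply (σ.injective.mem_periodicPts x), hp, Nat.succ_eq_add_one,
    walkProd_succ, Nat.add_sub_cancel, pow_succ', Perm.mul_apply, hx]

lemma cycleProd_of_apply_eq {σ : Perm (Fin n)} {x : Fin n} (h : σ x = x) :
    cycleProd A σ x = A x x := by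
  rw [cycleProd_eq_mul_walkProd, minimalPeriod_eq_of_forall_pow_apply_ne one_pos h
    fun t h0 h1 => absurd h0 (by lia), h, Nat.sub_self, walkProd_zero, mul_one]

lemma cycleProd_of_apply_apply_eq {σ : Perm (Fin n)} {x : Fin n} (h : σ (σ x) = x)
    (hne : σ x ≠ x) : cycleProd A σ x = A x (σ x) * A (σ x) x := by
  have hp : Function.minimalPeriod σ x = 2 :=
    minimalPeriod_eq_of_forall_pow_apply_ne two_pos h fun t h0 h1 => by
      obtain rfl : t = 1 := by lia
      exact hne
  rw [cycleProd_eq_mul_walkProd, hp, walkProd_succ', h, walkProd_zero, mul_one]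

lemma map_cycleProd {T : Type*} [Ring T] (f : S →+* T) :
    cycleProd (A.map f) σ x = f (cycleProd A σ x) := by
  simp only [cycleProd, map_list_prod, List.map_map, Function.comp_def, map_apply]

lemma cycleProd_conjTranspose_inv [StarRing S] :
    cycleProd Aᴴ σ⁻¹ x = star (cycleProd A σ x) := by
  rw [cycleProd_eq_walkProd, cycleProd_eq_walkProd, star_walkProd, minimalPeriod_inv,
    pow_minimalPeriod_apply]

variable {A σ x} {B : Matrix (Fin n) (Fin n) S} {τ : Perm (Fin n)}

lemma cycleProd_congr (h : ∀ y, σ.SameCycle x y → τ y = σ y)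
    (hAB : ∀ y, σ.SameCycle x y → B y (σ y) = A y (σ y)) :
    cycleProd B τ x = cycleProd A σ x := by
  rw [cycleProd_eq_walkProd, cycleProd_eq_walkProd, minimalPeriod_congr h]
  refine walkProd_congr fun s _ => ?_
  rw [pow_apply_congr h, pow_apply_congr h, pow_succ', Perm.mul_apply]
  exact hAB _ (Perm.sameCycle_pow_right.2 .rfl)

lemma cycleProd_updateRow_of_not_sameCycle {i : Fin n} (h : ¬ σ.SameCycle i x) (v : Fin n → S) :
    cycleProd (A.updateRow i v) σ x = cycleProd A σ x :=
  cycleProd_congr (fun _ _ => rfl) fun y hy => by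
    rw [updateRow_ne]
    rintro rfl
    exact h hy.symm

lemma cycleProd_updateRow_self (A : Matrix (Fin n) (Fin n) S) (σ : Perm (Fin n)) (i : Fin n)
    (v : Fin n → S) :
    cycleProd (A.updateRow i v) σ i =
      v (σ i) * walkProd A σ (σ i) (Function.minimalPeriod σ i - 1) := by
  rw [cycleProd_eq_mul_walkProd, updateRow_self]
  congr 1
  refine walkProd_congr fun s hs => ?_
  rw [updateRow_ne]
  rw [← Perm.mul_apply, ← pow_succ]
  exact pow_apply_ne_of_lt_minimalPeriod s.succ_pos (by lia)

lemma walkProd_mul_swap {i k : Fin n} (h : ¬ σ.SameCycle i k) (hA : A i = A k) :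
    walkProd A (σ * Equiv.swap i k) i (Function.minimalPeriod σ k) = cycleProd A σ k := by
  refine walkProd_congr fun s hs => ?_
  rw [pow_mul_swap_apply h hs]
  cases s with
  | zero => rw [pow_zero, pow_zero, Perm.one_apply, Perm.one_apply, hA]
  | succ s => rw [pow_mul_swap_apply h (by lia)]

lemma cycleProd_mul_swap {i k : Fin n} (h : ¬ σ.SameCycle i k) (hA : A i = A k) :
    cycleProd A (σ * Equiv.swap i k) i = cycleProd A σ k * cycleProd A σ i := by
  rw [cycleProd_eq_walkProd, minimalPeriod_mul_swap h, walkProd_add, walkProd_mul_swap h hA,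
    pow_minimalPeriod_mul_swap_apply h, Equiv.swap_comm,
    walkProd_mul_swap (fun e => h e.symm) hA.symm]

end CycleProd

section CycleMin

section LinearOrder

variable {α : Type*} [LinearOrder α] {σ τ : Perm α} {m k : α}

/-- `m` is the smallest element of its cycle under `σ`; such elements represent the cycles. -/
def IsCycleMin (σ : Perm α) (m : α) : Prop := ∀ l, σ.SameCycle m l → m ≤ l

lemma isCycleMin_congr [Finite α] (h : ∀ y, σ.SameCycle m y → τ y = σ y) :
    IsCycleMin τ m ↔ IsCycleMin σ m := by
  simp only [IsCycleMin, sameCycle_congr h]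

lemma IsCycleMin.eq (hm : IsCycleMin σ m) (hk : IsCycleMin σ k) (h : σ.SameCycle m k) : m = k :=
  le_antisymm (hm _ h) (hk _ h.symm)

lemma exists_sameCycle_isCycleMin [Finite α] (σ : Perm α) (k : α) :
    ∃ m, σ.SameCycle k m ∧ IsCycleMin σ m := by
  obtain ⟨m, hm, hmin⟩ :=
    Set.exists_min_image {m | σ.SameCycle k m} id (Set.toFinite _) ⟨k, .rfl⟩
  exact ⟨m, hm, fun l hl => hmin l (hm.trans hl)⟩

end LinearOrder

variable {n : ℕ} {σ : Perm (Fin n)} {m k : Fin n}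

lemma mem_otherCycleMins : m ∈ otherCycleMins σ k ↔ ¬ σ.SameCycle k m ∧ IsCycleMin σ m := by
  simp only [otherCycleMins, Finset.mem_sort, Finset.mem_filter, Finset.mem_univ, true_and,
    IsCycleMin]

lemma nodup_otherCycleMins : (otherCycleMins σ k).Nodup :=
  Finset.sort_nodup _ _

lemma otherCycleMins_flipCycle : otherCycleMins (flipCycle σ m) k = otherCycleMins σ k := by
  simp only [otherCycleMins, sameCycle_flipCycle]

lemma otherCycleMins_inv : otherCycleMins σ⁻¹ k = otherCycleMins σ k := by
  simp only [otherCycleMins, Perm.sameCycle_inv]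

end CycleMin

section Averaging

variable {R : Type*} [CommRing R] {a b : R}

lemma re_mul_comm (x y : ℍ[R,a,b]) : (x * y).re = (y * x).re := by
  simp only [QuaternionAlgebra.re_mul]
  ring

variable {Ω ι : Type*} {T : Finset Ω} {φ : Ω → Ω}

/-- `φ` is an involution of `T` along which the quaternion-valued function `x` is conjugated.
At fixed points of `φ` the value of `x` is required to be a scalar, which conjugation invariance
alone does not give in characteristic two. -/
structure IsConjInvolution (T : Finset Ω) (φ : Ω → Ω) (x : Ω → ℍ[R,a,b]) : Prop where
  mem : ∀ ω ∈ T, φ ω ∈ T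
  involutive : ∀ ω ∈ T, φ (φ ω) = ω
  conj : ∀ ω ∈ T, x (φ ω) = star (x ω)
  fixed : ∀ ω ∈ T, φ ω = ω → x ω = ((x ω).re : ℍ[R,a,b])

lemma IsConjInvolution.sum_mul_mul {x : Ω → ℍ[R,a,b]} (h : IsConjInvolution T φ x)
    {P Q : Ω → ℍ[R,a,b]} (hP : ∀ ω ∈ T, P (φ ω) = P ω) (hQ : ∀ ω ∈ T, Q (φ ω) = Q ω) :
    ∑ ω ∈ T, P ω * x ω * Q ω = ∑ ω ∈ T, P ω * ((x ω).re : ℍ[R,a,b]) * Q ω := by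
  rw [← sub_eq_zero, ← Finset.sum_sub_distrib]
  refine Finset.sum_involution (fun ω _ => φ ω) (fun ω hω => ?_) (fun ω hω hne he => hne ?_)
    h.mem h.involutive
  · rw [hP ω hω, hQ ω hω, h.conj ω hω, QuaternionAlgebra.re_star, zero_mul, add_zero]
    calc _ = P ω * (x ω + star (x ω) - ((x ω).re + (x ω).re)) * Q ω := by noncomm_ring
      _ = 0 := by simp [QuaternionAlgebra.self_add_star, two_mul]
  · rw [← h.fixed ω hω he, sub_self]

lemma sum_mul_list_prod_eq_sum_mul_coe {x : ι → Ω → ℍ[R,a,b]} {φ : ι → Ω → Ω} {L : List ι}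
    (hL : L.Nodup) (h : ∀ m ∈ L, IsConjInvolution T (φ m) (x m))
    (hx : ∀ m ∈ L, ∀ k ∈ L, m ≠ k → ∀ ω ∈ T, x k (φ m ω) = x k ω)
    {P : Ω → ℍ[R,a,b]} (hP : ∀ m ∈ L, ∀ ω ∈ T, P (φ m ω) = P ω) :
    ∑ ω ∈ T, P ω * (L.map (x · ω)).prod =
      ∑ ω ∈ T, P ω * ((L.map fun m => (x m ω).re).prod : R) := by
  induction L generalizing P with
  | nil => simp
  | cons m L ih =>
    obtain ⟨hm, hL⟩ := List.nodup_cons.1 hL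
    have hm' : m ∈ m :: L := List.mem_cons_self
    have hL' : ∀ k ∈ L, k ∈ m :: L := fun k => List.mem_cons_of_mem m
    have hne : ∀ k ∈ L, m ≠ k := fun k hk e => hm (e ▸ hk)
    have tail := ih hL (fun k hk => h k (hL' k hk)) (P := fun ω => P ω * x m ω)
      (fun k hk l hl => hx k (hL' k hk) l (hL' l hl)) fun k hk ω hω => by
        rw [hP k (hL' k hk) ω hω, hx k (hL' k hk) m hm' (hne k hk).symm ω hω]
    have head := (h m hm').sum_mul_mul (hP m hm')
      (Q := fun ω => (((L.map fun k => (x k ω).re).prod : R) : ℍ[R,a,b])) fun ω hω => by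
        congr 2
        exact List.map_congr_left fun k hk => by rw [hx m hm' k (hL' k hk) (hne k hk) ω hω]
    simp only [List.map_cons, List.prod_cons, ← mul_assoc, QuaternionAlgebra.coe_mul]
    exact tail.trans head

end Averaging

section ScalarHermitian

variable {R : Type*} [CommRing R] {a b : R}

/-- The submatrix of `A` on `s` is Hermitian with scalar diagonal. The second condition follows
from the first one only if `2` is not a zero divisor. -/
structure IsScalarHermitianOn {ι : Type*} (A : Matrix ι ι ℍ[R,a,b]) (s : Set ι) : Prop where
  star_apply : ∀ p ∈ s, ∀ q ∈ s, star (A p q) = A q p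
  diag : ∀ p ∈ s, A p p = ((A p p).re : ℍ[R,a,b])

section Basic

variable {ι : Type*} {A B : Matrix ι ι ℍ[R,a,b]} {s t : Set ι}

lemma IsScalarHermitianOn.mono (h : IsScalarHermitianOn A t) (hst : s ⊆ t) :
    IsScalarHermitianOn A s where
  star_apply p hp q hq := h.star_apply p (hst hp) q (hst hq)
  diag p hp := h.diag p (hst hp)

lemma IsScalarHermitianOn.congr (h : IsScalarHermitianOn A s)
    (hAB : ∀ p ∈ s, ∀ q ∈ s, B p q = A p q) : IsScalarHermitianOn B s where
  star_apply p hp q hq := by rw [hAB p hp q hq, hAB q hq p hp, h.star_apply p hp q hq]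
  diag p hp := by rw [hAB p hp p hp]; exact h.diag p hp

lemma IsScalarHermitianOn.conjTranspose (h : IsScalarHermitianOn A s) :
    IsScalarHermitianOn Aᴴ s :=
  h.congr fun p hp q hq => h.star_apply q hq p hp

end Basic

variable {n : ℕ} {A B : Matrix (Fin n) (Fin n) ℍ[R,a,b]} {s : Set (Fin n)}
  {σ τ : Perm (Fin n)} {i k m : Fin n}

lemma cycleProd_flipCycle_of_not_sameCycle (h : ¬ σ.SameCycle m k) :
    cycleProd A (flipCycle σ m) k = cycleProd A σ k :=
  cycleProd_congr (flipCycle_eq_on_other_cycle h) fun _ _ => rfl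

lemma IsScalarHermitianOn.cycleProd_flipCycle (h : IsScalarHermitianOn A s)
    (hs : ∀ y, σ.SameCycle m y → y ∈ s) :
    cycleProd A (flipCycle σ m) m = star (cycleProd A σ m) := by
  rw [← cycleProd_conjTranspose_inv]
  refine cycleProd_congr (fun y hy => ?_) fun y hy => ?_ <;> rw [Perm.sameCycle_inv] at hy
  · exact flipCycle_apply_of_sameCycle hy
  · exact (h.star_apply _ (hs _ (Perm.sameCycle_symm_apply_right.2 hy)) _ (hs _ hy)).symm

lemma IsScalarHermitianOn.cycleProd_eq_coe_re (h : IsScalarHermitianOn A s)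
    (hs : ∀ y, σ.SameCycle m y → y ∈ s) (hflip : flipCycle σ m = σ) :
    cycleProd A σ m = ((cycleProd A σ m).re : ℍ[R,a,b]) := by
  have hσσ : σ (σ m) = m := by
    rw [← Perm.eq_inv_iff_eq, ← flipCycle_apply_of_sameCycle (Perm.SameCycle.refl σ m), hflip]
  by_cases hσ : σ m = m
  · rw [cycleProd_of_apply_eq A hσ]
    exact h.diag m (hs m .rfl)
  · rw [cycleProd_of_apply_apply_eq A hσσ hσ, ← h.star_apply m (hs m .rfl) (σ m)
      (hs _ (Perm.sameCycle_apply_right.2 .rfl)), ← QuaternionAlgebra.mul_star_eq_coe]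

lemma IsScalarHermitianOn.isConjInvolution_flipCycle (h : IsScalarHermitianOn A s)
    {T : Finset (Perm (Fin n))} (hT : ∀ σ ∈ T, flipCycle σ m ∈ T)
    (hs : ∀ σ ∈ T, ∀ y, σ.SameCycle m y → y ∈ s) :
    IsConjInvolution T (flipCycle · m) (cycleProd A · m) where
  mem := hT
  involutive σ _ := flipCycle_flipCycle σ m
  conj σ hσ := h.cycleProd_flipCycle (hs σ hσ)
  fixed σ hσ := h.cycleProd_eq_coe_re (hs σ hσ)

lemma re_cycleProd_apply (A : Matrix (Fin n) (Fin n) ℍ[R,a,b]) (σ : Perm (Fin n)) (k : Fin n) :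
    (cycleProd A σ (σ k)).re = (cycleProd A σ k).re := by
  rw [cycleProd_apply_eq_walkProd_mul, cycleProd_eq_mul_walkProd, re_mul_comm]

lemma re_cycleProd_eq_of_sameCycle (A : Matrix (Fin n) (Fin n) ℍ[R,a,b]) (h : σ.SameCycle k m) :
    (cycleProd A σ m).re = (cycleProd A σ k).re :=
  sameCycle_induction (p := fun y => (cycleProd A σ y).re = (cycleProd A σ k).re)
    (fun y hy => (re_cycleProd_apply A σ y).trans hy) rfl h

/-- The product of the real parts of the cycle products of `σ`, over those cycles whose smallest
element lies in `s`. -/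
noncomputable def cyclesRe (A : Matrix (Fin n) (Fin n) ℍ[R,a,b]) (σ : Perm (Fin n))
    (s : Set (Fin n)) : R :=
  ∏ᶠ m ∈ s ∩ {m | IsCycleMin σ m}, (cycleProd A σ m).re

lemma cyclesRe_congr (hτ : ∀ m ∈ s, ∀ y, σ.SameCycle m y → τ y = σ y)
    (hAB : ∀ m ∈ s, ∀ y, σ.SameCycle m y → B y (σ y) = A y (σ y)) :
    cyclesRe B τ s = cyclesRe A σ s :=
  finprod_mem_congr (Set.ext fun m => and_congr_right fun hm => isCycleMin_congr (hτ m hm))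
    fun m hm => by rw [cycleProd_congr (hτ m hm.1) (hAB m hm.1)]

lemma cyclesRe_eq_mul (A : Matrix (Fin n) (Fin n) ℍ[R,a,b]) (hk : ∀ m, σ.SameCycle k m → m ∈ s) :
    cyclesRe A σ s = (cycleProd A σ k).re * cyclesRe A σ (s \ {m | σ.SameCycle k m}) := by
  obtain ⟨m, hm, hmin⟩ := exists_sameCycle_isCycleMin σ k
  have hinsert : s ∩ {l | IsCycleMin σ l} =
      insert m (s \ {l | σ.SameCycle k l} ∩ {l | IsCycleMin σ l}) := by
    refine Set.ext fun l => ⟨fun ⟨hl, hlmin⟩ => ?_, ?_⟩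
    · by_cases hkl : σ.SameCycle k l
      · exact Or.inl (hlmin.eq hmin (hkl.symm.trans hm))
      · exact Or.inr ⟨⟨hl, hkl⟩, hlmin⟩
    · rintro (rfl | ⟨⟨hl, -⟩, hlmin⟩)
      · exact ⟨hk _ hm, hmin⟩
      · exact ⟨hl, hlmin⟩
  rw [← re_cycleProd_eq_of_sameCycle A hm, cyclesRe, hinsert]
  exact finprod_mem_insert _ (fun h => h.1.2 hm) (Set.toFinite _)

lemma cyclesRe_flipCycle (hm : ∀ k ∈ s, ¬ σ.SameCycle m k) :
    cyclesRe A (flipCycle σ m) s = cyclesRe A σ s :=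
  cyclesRe_congr (fun k hk => flipCycle_eq_on_other_cycle (hm k hk)) fun _ _ _ _ => rfl

lemma cyclesRe_conjTranspose_inv : cyclesRe Aᴴ σ⁻¹ s = cyclesRe A σ s := by
  simp only [cyclesRe, IsCycleMin, Perm.sameCycle_inv, cycleProd_conjTranspose_inv,
    QuaternionAlgebra.re_star, zero_mul, add_zero]

lemma list_prod_re_cycleProd (A : Matrix (Fin n) (Fin n) ℍ[R,a,b]) (σ : Perm (Fin n))
    (i : Fin n) :
    ((otherCycleMins σ i).map fun m => (cycleProd A σ m).re).prod =
      cyclesRe A σ {m | ¬ σ.SameCycle i m} := by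
  classical
  rw [← List.prod_toFinset _ nodup_otherCycleMins, ← finprod_mem_coe_finset]
  exact finprod_mem_congr (Set.ext fun m => List.mem_toFinset.trans mem_otherCycleMins)
    fun _ _ => rfl

/-- Reversing a cycle not through `i` changes neither the sign of `σ` nor the other cycles, and
averaging over the reversals turns each cycle product away from `i` into its real part. -/
lemma IsScalarHermitianOn.rdet_eq_sum (h : IsScalarHermitianOn A {i}ᶜ) :
    rdet i A = ∑ σ : Perm (Fin n), (Perm.sign σ : ℤ) •
      (cycleProd A σ i * ((cyclesRe A σ {m | ¬ σ.SameCycle i m} : R) : ℍ[R,a,b])) := by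
  have fiber (L : List (Fin n)) (hL : L.Nodup) :
      ∑ σ : Perm (Fin n) with otherCycleMins σ i = L,
        ((Perm.sign σ : ℤ) • cycleProd A σ i) * (L.map (cycleProd A σ)).prod =
      ∑ σ : Perm (Fin n) with otherCycleMins σ i = L,
        ((Perm.sign σ : ℤ) • cycleProd A σ i) *
          ((L.map fun m => (cycleProd A σ m).re).prod : R) := by
    have hmem {m : Fin n} (hm : m ∈ L) {σ : Perm (Fin n)}
        (hσ : σ ∈ ({σ | otherCycleMins σ i = L} : Finset (Perm (Fin n)))) :
        ¬ σ.SameCycle i m ∧ IsCycleMin σ m :=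
      mem_otherCycleMins.1 ((Finset.mem_filter.1 hσ).2 ▸ hm)
    refine sum_mul_list_prod_eq_sum_mul_coe (φ := fun m σ => flipCycle σ m) hL
      (fun m hm => h.isConjInvolution_flipCycle (fun σ hσ => ?_) fun σ hσ y hy hyi => ?_)
      (fun m hm k hk hmk σ hσ => ?_) fun m hm σ hσ => ?_
    · simpa only [Finset.mem_filter, Finset.mem_univ, true_and, otherCycleMins_flipCycle] using hσ
    · exact (hmem hm hσ).1 (hyi ▸ hy.symm)
    · exact cycleProd_flipCycle_of_not_sameCycle
        fun e => hmk ((hmem hm hσ).2.eq (hmem hk hσ).2 e)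
    · rw [sign_flipCycle, cycleProd_flipCycle_of_not_sameCycle fun e => (hmem hm hσ).1 e.symm]
  have himage : ∀ σ ∈ Finset.univ, otherCycleMins σ i ∈ Finset.univ.image (otherCycleMins · i) :=
    fun σ => Finset.mem_image_of_mem _
  rw [rdet, ← Finset.sum_fiberwise_of_maps_to himage, ← Finset.sum_fiberwise_of_maps_to himage]
  refine Finset.sum_congr rfl fun L hL => ?_
  obtain ⟨τ, -, rfl⟩ := Finset.mem_image.1 hL
  refine Eq.trans (Finset.sum_congr rfl fun σ hσ => ?_)
    ((fiber _ nodup_otherCycleMins).trans (Finset.sum_congr rfl fun σ hσ => ?_)) <;>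
    rw [← (Finset.mem_filter.1 hσ).2, smul_mul_assoc]
  rw [list_prod_re_cycleProd]

end ScalarHermitian

section RowDeterminant

variable {n : ℕ} {S : Type*} [Ring S]

/-- The row determinant analogue of the adjugate matrix: the `i`-th row determinant of a matrix
whose `i`-th row has been replaced by `v` is the `i`-th entry of `v ᵥ* rowAdjugate A`. -/
noncomputable def rowAdjugate (A : Matrix (Fin n) (Fin n) S) : Matrix (Fin n) (Fin n) S :=
  .of fun j i => rdet i (A.updateRow i (Pi.single j 1))

lemma rdet_updateRow (A : Matrix (Fin n) (Fin n) S) (i : Fin n) (v : Fin n → S) :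
    rdet i (A.updateRow i v) = (v ᵥ* rowAdjugate A) i := by
  have hother (σ : Perm (Fin n)) (w : Fin n → S) :
      (otherCycleMins σ i).map (cycleProd (A.updateRow i w) σ) =
        (otherCycleMins σ i).map (cycleProd A σ) :=
    List.map_congr_left fun m hm =>
      cycleProd_updateRow_of_not_sameCycle (mem_otherCycleMins.1 hm).1 w
  simp only [vecMul, dotProduct, rowAdjugate, of_apply, rdet, hother, cycleProd_updateRow_self,
    Finset.mul_sum]
  rw [Finset.sum_comm]
  refine Finset.sum_congr rfl fun σ _ => ?_
  rw [Finset.sum_eq_single (σ i)]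
  · rw [Pi.single_eq_same, one_mul, mul_smul_comm, mul_assoc]
  · intro j _ hj
    rw [Pi.single_eq_of_ne hj.symm, zero_mul, zero_mul, smul_zero, mul_zero]
  · exact fun h => absurd (Finset.mem_univ _) h

lemma mul_rowAdjugate_apply (A : Matrix (Fin n) (Fin n) S) (j i : Fin n) :
    (A * rowAdjugate A) j i = rdet i (A.updateRow i (A j)) :=
  (rdet_updateRow A i (A j)).symm

lemma star_list_prod_map [StarRing S] {ι : Type*} (f : ι → S) (L : List ι) :
    star (L.map f).prod = (L.reverse.map fun m => star (f m)).prod := by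
  induction L with
  | nil => simp
  | cons m L ih => simp [ih]

lemma cdet_eq_star_rdet [StarRing S] (j : Fin n) (A : Matrix (Fin n) (Fin n) S) :
    cdet j A = star (rdet j Aᴴ) := by
  rw [rdet, star_sum, cdet, ← Equiv.sum_comp (Equiv.inv (Perm (Fin n)))]
  refine Finset.sum_congr rfl fun σ _ => ?_
  have hstar : cycleProd A σ⁻¹ = fun x => star (cycleProd Aᴴ σ x) := by
    ext1 x
    rw [← cycleProd_conjTranspose_inv, conjTranspose_conjTranspose]
  rw [Equiv.inv_apply, otherCycleMins_inv, Perm.sign_inv, star_zsmul, star_mul, hstar,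
    star_list_prod_map]

end RowDeterminant

section MooreDeterminant

variable {R : Type*} [CommRing R] {a b : R} {n : ℕ} {A : Matrix (Fin n) (Fin n) ℍ[R,a,b]}
  {σ : Perm (Fin n)} {i j k : Fin n}

/-- The Moore determinant of a Hermitian matrix with scalar diagonal. It does not favour any row;
all row determinants of such a matrix are equal to it. -/
noncomputable def mooreDet (A : Matrix (Fin n) (Fin n) ℍ[R,a,b]) : R :=
  ∑ σ : Perm (Fin n), (Perm.sign σ : ℤ) • cyclesRe A σ Set.univ

lemma IsScalarHermitianOn.rdet_eq_mooreDet (h : IsScalarHermitianOn A Set.univ) (i : Fin n) :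
    rdet i A = ((mooreDet A : R) : ℍ[R,a,b]) := by
  have hflip := h.isConjInvolution_flipCycle (m := i) (T := Finset.univ)
    (fun _ _ => Finset.mem_univ _) fun _ _ _ _ => trivial
  have havg := hflip.sum_mul_mul (P := fun σ => ((Perm.sign σ : ℤ) : ℍ[R,a,b]))
    (Q := fun σ => ((cyclesRe A σ {m | ¬ σ.SameCycle i m} : R) : ℍ[R,a,b]))
    (fun σ _ => by rw [sign_flipCycle]) fun σ _ => by
      simp only [sameCycle_flipCycle]
      rw [cyclesRe_flipCycle (s := {m | ¬ σ.SameCycle i m}) fun _ hk => hk]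
  rw [(h.mono (Set.subset_univ _)).rdet_eq_sum, mooreDet, ← QuaternionAlgebra.coe_algebraMap,
    map_sum]
  simp only [zsmul_eq_mul, ← mul_assoc]
  refine havg.trans (Finset.sum_congr rfl fun σ _ => ?_)
  rw [cyclesRe_eq_mul A fun m (_ : σ.SameCycle i m) => Set.mem_univ m, ← Set.compl_eq_univ_sdiff,
    map_mul, map_intCast, map_mul, ← mul_assoc]
  rfl

lemma cyclesRe_mul_swap (hik : ¬ σ.SameCycle i k) :
    cyclesRe A (σ * Equiv.swap i k) {m | ¬ (σ * Equiv.swap i k).SameCycle i m} =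
      cyclesRe A σ ({m | ¬ σ.SameCycle i m} \ {m | σ.SameCycle k m}) := by
  have hset : {m | ¬ (σ * Equiv.swap i k).SameCycle i m} =
      {m | ¬ σ.SameCycle i m} \ {m | σ.SameCycle k m} :=
    Set.ext fun m => (not_congr (sameCycle_mul_swap_iff hik)).trans not_or
  rw [hset]
  refine cyclesRe_congr (fun m hm y hy => ?_) fun _ _ _ _ => rfl
  rw [Perm.mul_apply, Equiv.swap_apply_of_ne_of_ne]
  · exact fun e => hm.1 (e ▸ hy.symm)
  · exact fun e => hm.2 (e ▸ hy.symm)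

/-- Composition with `swap i k` merges the cycles through `i` and `k`, so the terms of the row
determinant cancel in pairs once the cycle product through `k` is averaged. -/
lemma IsScalarHermitianOn.rdet_eq_zero_of_row_eq (h : IsScalarHermitianOn A {i}ᶜ) (hik : i ≠ k)
    (hrow : A i = A k) : rdet i A = 0 := by
  set T : Finset (Perm (Fin n)) := {σ | ¬ σ.SameCycle i k}
  have hT {σ : Perm (Fin n)} : σ ∈ T ↔ ¬ σ.SameCycle i k :=
    Finset.mem_filter.trans (and_iff_right (Finset.mem_univ σ))
  let Q (σ : Perm (Fin n)) : ℍ[R,a,b] := cycleProd A σ i *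
    ((cyclesRe A σ ({m | ¬ σ.SameCycle i m} \ {m | σ.SameCycle k m}) : R) : ℍ[R,a,b])
  have hflip : IsConjInvolution T (flipCycle · k) (cycleProd A · k) :=
    h.isConjInvolution_flipCycle (fun σ hσ => by rwa [hT, sameCycle_flipCycle, ← hT])
      fun σ hσ y hy hyi => hT.1 hσ (hyi ▸ hy.symm)
  have havg := hflip.sum_mul_mul (P := fun σ => ((Perm.sign σ : ℤ) : ℍ[R,a,b])) (Q := Q)
    (fun σ _ => by rw [sign_flipCycle]) fun σ hσ => by
      simp only [Q, sameCycle_flipCycle]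
      rw [cycleProd_flipCycle_of_not_sameCycle fun e => hT.1 hσ e.symm,
        cyclesRe_flipCycle fun _ hm => hm.2]
  rw [h.rdet_eq_sum, sum_perm_eq_sum_not_sameCycle hik]
  rw [eq_comm, ← sub_eq_zero, ← Finset.sum_sub_distrib] at havg
  refine (Finset.sum_congr rfl fun σ hσ => ?_).trans havg
  have hσ' := hT.1 hσ
  have hsplit := cyclesRe_eq_mul A (s := {m | ¬ σ.SameCycle i m}) (k := k)
    fun m hm (e : σ.SameCycle i m) => hσ' (e.trans hm.symm)
  rw [cycleProd_mul_swap hσ' hrow, cyclesRe_mul_swap hσ', hsplit, Perm.sign_mul, Perm.sign_swap hik,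
    QuaternionAlgebra.coe_mul, ← mul_assoc (cycleProd A σ i),
    ← QuaternionAlgebra.coe_commutes (cycleProd A σ k).re]
  simp only [mul_neg, mul_one, Units.val_neg, neg_smul, zsmul_eq_mul, Q]
  noncomm_ring

lemma IsScalarHermitianOn.star_rdet_conjTranspose (h : IsScalarHermitianOn A {i}ᶜ) :
    star (rdet i Aᴴ) = rdet i A := by
  rw [h.conjTranspose.rdet_eq_sum, h.rdet_eq_sum, star_sum,
    ← Equiv.sum_comp (Equiv.inv (Perm (Fin n)))]
  refine Finset.sum_congr rfl fun σ _ => ?_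
  simp only [Equiv.inv_apply, Perm.sign_inv, Perm.sameCycle_inv, cycleProd_conjTranspose_inv,
    cyclesRe_conjTranspose_inv, star_zsmul, star_mul, star_star, QuaternionAlgebra.star_coe,
    QuaternionAlgebra.coe_commutes]

lemma IsScalarHermitianOn.updateRow (h : IsScalarHermitianOn A {i}ᶜ) (v : Fin n → ℍ[R,a,b]) :
    IsScalarHermitianOn (A.updateRow i v) {i}ᶜ :=
  h.congr fun _ hp _ _ => by rw [updateRow_ne hp]

lemma IsScalarHermitianOn.mul_rowAdjugate_apply (h : IsScalarHermitianOn A {i}ᶜ) (j : Fin n) :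
    (A * rowAdjugate A) j i = if j = i then rdet i A else 0 := by
  rw [DoubleCofactor.mul_rowAdjugate_apply]
  split_ifs with hji
  · rw [hji, updateRow_eq_self]
  · refine (h.updateRow _).rdet_eq_zero_of_row_eq (Ne.symm hji) ?_
    rw [updateRow_self, updateRow_ne hji]

lemma IsScalarHermitianOn.mul_rowAdjugate (h : IsScalarHermitianOn A Set.univ) :
    A * rowAdjugate A = mooreDet A • 1 := by
  ext1 j i
  rw [(h.mono (Set.subset_univ _)).mul_rowAdjugate_apply, h.rdet_eq_mooreDet,
    Matrix.smul_apply, one_apply, smul_ite, smul_zero, Algebra.smul_def, mul_one]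
  rfl

lemma IsScalarHermitianOn.rdet_updateRow_vecMul (h : IsScalarHermitianOn A {i}ᶜ)
    (v : Fin n → ℍ[R,a,b]) : rdet i (A.updateRow i (v ᵥ* A)) = v i * rdet i A := by
  rw [rdet_updateRow, vecMul_vecMul, vecMul, dotProduct]
  simp only [h.mul_rowAdjugate_apply, mul_ite, mul_zero, Finset.sum_ite_eq', Finset.mem_univ,
    if_true]

end MooreDeterminant

section Elementary

variable {m S T : Type*} [Fintype m] [DecidableEq m] [Ring S] [Ring T]

variable (m S) in
/-- The submonoid generated by the invertible matrices that differ from the identity in at most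
one entry, possibly on the diagonal. -/
def elementaryMonoid : Submonoid (Matrix m m S) :=
  .closure {E | IsUnit E ∧ ∃ i j c, E = 1 + single i j c}

lemma isUnit_of_mem_elementaryMonoid {A : Matrix m m S} (hA : A ∈ elementaryMonoid m S) :
    IsUnit A :=
  (Submonoid.closure_le.2 fun _ hE => hE.1 : elementaryMonoid m S ≤ IsUnit.submonoid _) hA

lemma one_add_single_mem {i j : m} (hij : i ≠ j) (c : S) :
    1 + single i j c ∈ elementaryMonoid m S := by
  have hnil : IsNilpotent (single i j c) :=
    ⟨2, by rw [sq, single_mul_single_of_ne _ _ _ _ hij.symm]⟩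
  exact Submonoid.subset_closure ⟨hnil.isUnit_one_add, i, j, c, rfl⟩

lemma one_add_single_self_mem (k : m) {p : S} (hp : IsUnit p) :
    1 + single k k (p - 1) ∈ elementaryMonoid m S := by
  refine Submonoid.subset_closure ⟨?_, k, k, _, rfl⟩
  have hmul (x y : S) (hxy : x * y = 1) :
      (1 + single k k (x - 1)) * (1 + single k k (y - 1)) = (1 : Matrix m m S) := by
    rw [add_mul, mul_add, mul_add, one_mul, one_mul, mul_one, single_mul_single_same, add_assoc,
      ← single_add, ← single_add]
    have : y - 1 + (x - 1 + (x - 1) * (y - 1)) = x * y - 1 := by noncomm_ring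
    rw [this, hxy, sub_self, single_zero, add_zero]
  obtain ⟨u, rfl⟩ := hp
  exact ⟨⟨_, _, hmul _ _ u.mul_inv, hmul _ _ u.inv_mul⟩, rfl⟩

lemma one_add_mem_of_offDiagonal {X : Matrix m m S} {s : Set m}
    (hX : ∀ i j, X i j ≠ 0 → i ∈ s ∧ j ∉ s) : 1 + X ∈ elementaryMonoid m S := by
  have hsum (t : Finset (m × m)) :
      1 + ∑ p ∈ t, single p.1 p.2 (X p.1 p.2) ∈ elementaryMonoid m S := by
    induction t using Finset.induction_on with
    | empty => simpa only [Finset.sum_empty, add_zero] using one_mem _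
    | insert p t hp ih =>
      rw [Finset.sum_insert hp]
      by_cases hp0 : X p.1 p.2 = 0
      · rwa [hp0, single_zero, zero_add]
      obtain ⟨hp1, hp2⟩ := hX _ _ hp0
      have hmul : single p.1 p.2 (X p.1 p.2) * ∑ q ∈ t, single q.1 q.2 (X q.1 q.2) = 0 := by
        rw [Finset.mul_sum]
        refine Finset.sum_eq_zero fun q _ => ?_
        by_cases hq0 : X q.1 q.2 = 0
        · rw [hq0, single_zero, mul_zero]
        · exact single_mul_single_of_ne _ _ _ _ (fun h : p.2 = q.1 => hp2 (h ▸ (hX _ _ hq0).1)) _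
      have hne : p.1 ≠ p.2 := fun h => hp2 (h ▸ hp1)
      convert mul_mem (one_add_single_mem hne (X p.1 p.2)) ih using 1
      rw [add_mul, mul_add (single _ _ _), one_mul, mul_one, hmul, add_zero]
      abel
  convert hsum Finset.univ
  rw [Fintype.sum_prod_type]
  exact matrix_eq_sum_single X

/-- Gaussian elimination with the invertible pivot `A k k`: what remains to be factored is the
Schur complement of the pivot, bordered by a row and a column of the identity matrix. -/
lemma exists_eq_mul_mul_of_isUnit_apply (A : Matrix m m S) {k : m} (hk : IsUnit (A k k)) :
    ∃ L ∈ elementaryMonoid m S, ∃ U ∈ elementaryMonoid m S,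
      A = L * .of (fun i j => if i = k ∨ j = k then (1 : Matrix m m S) i j else
        A i j - A i k * ↑hk.unit⁻¹ * A k j) * U := by
  set q : S := ↑hk.unit⁻¹
  have hq : q * A k k = 1 := hk.val_inv_mul
  let w : Matrix m m S := .of fun i j => if j = k then if i = k then 0 else A i k * q else 0
  let r : Matrix m m S := .of fun i j => if i = k then if j = k then 0 else A k j else 0
  have hw : 1 + w ∈ elementaryMonoid m S :=
    one_add_mem_of_offDiagonal (s := {k}ᶜ) fun i j hij => by
      by_cases hj : j = k <;> by_cases hi : i = k <;> simp_all [w]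
  have hr : 1 + r ∈ elementaryMonoid m S :=
    one_add_mem_of_offDiagonal (s := {k}) fun i j hij => by
      by_cases hj : j = k <;> by_cases hi : i = k <;> simp_all [r]
  refine ⟨_, hw, _, mul_mem hr (one_add_single_self_mem k hk), ?_⟩
  have hw_mul (M : Matrix m m S) (i j : m) :
      ((1 + w) * M) i j = M i j + (if i = k then 0 else A i k * q) * M k j := by
    rw [add_mul, one_mul, Matrix.add_apply, mul_apply]
    simp [w]
  have hmul_r (M : Matrix m m S) (i j : m) :
      (M * (1 + r)) i j = M i j + M i k * (if j = k then 0 else A k j) := by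
    rw [mul_add, mul_one, Matrix.add_apply, mul_apply]
    simp [r]
  have hmul_single (M : Matrix m m S) (i j : m) :
      (M * (1 + single k k (A k k - 1))) i j =
        M i j + if j = k then M i k * (A k k - 1) else 0 := by
    by_cases hj : j = k
    · simp [hj, mul_add]
    · simp [hj, mul_add, mul_single_apply_of_ne]
  ext i j
  rw [← mul_assoc, hmul_single, hmul_r, hmul_r, hw_mul, hw_mul]
  by_cases hi : i = k <;> by_cases hj : j = k <;>
    simp [hi, hj, one_apply, eq_comm (a := k), mul_sub, mul_assoc, hq]

lemma mem_elementaryMonoid_of_map_eq_one (f : S →+* T) [IsLocalHom f] {A : Matrix m m S}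
    (hA : A.map f = 1) : A ∈ elementaryMonoid m S := by
  suffices hsupport : ∀ (s : Finset m) (B : Matrix m m S), B.map f = 1 →
      (∀ i j, i ∉ s ∨ j ∉ s → B i j = (1 : Matrix m m S) i j) → B ∈ elementaryMonoid m S from
    hsupport Finset.univ A hA fun i j h => by simp at h
  intro s
  induction s using Finset.induction_on with
  | empty =>
    intro B _ hB
    obtain rfl : B = 1 := Matrix.ext fun i j => hB i j (Or.inl (Finset.notMem_empty i))
    exact one_mem _
  | insert k s _ ih =>
    intro B hBf hB
    have hf (i j : m) : f (B i j) = (1 : Matrix m m T) i j := congrFun₂ hBf i j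
    have hpivot : IsUnit (B k k) := by
      refine isUnit_of_map_unit f _ ?_
      rw [hf, one_apply_eq]
      exact isUnit_one
    obtain ⟨L, hL, U, hU, hLU⟩ := exists_eq_mul_mul_of_isUnit_apply B hpivot
    rw [hLU]
    refine mul_mem (mul_mem hL (ih _ (Matrix.ext fun i j => ?_) fun i j hij => ?_)) hU
    · simp only [map_apply, of_apply]
      split_ifs with h
      · simp [one_apply]
      · simp [hf, one_apply_ne (not_or.1 h).1]
    · rw [of_apply]
      split_ifs with h
      · rfl
      · obtain ⟨hi, hj⟩ := not_or.1 h
        rw [hB i j (by simpa [hi, hj] using hij), sub_eq_self]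
        rcases hij with his | hjs
        · rw [hB i k (by simp [hi, his]), one_apply_ne hi, zero_mul, zero_mul]
        · rw [hB k j (by simp [hj, hjs]), one_apply_ne (Ne.symm hj), mul_zero]

end Elementary

section GramDeterminant

variable {R : Type*} [CommRing R] {a b : R} {n : ℕ}

lemma isScalarHermitianOn_mul_conjTranspose {ι : Type*} [Fintype ι] (A : Matrix ι ι ℍ[R,a,b])
    (s : Set ι) : IsScalarHermitianOn (A * Aᴴ) s where
  star_apply p _ q _ := by
    rw [← conjTranspose_apply, conjTranspose_mul, conjTranspose_conjTranspose]
  diag p _ := by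
    have hscalar (j : ι) :
        A p j * Aᴴ j p = algebraMap R ℍ[R,a,b] (A p j * Aᴴ j p).re :=
      QuaternionAlgebra.mul_star_eq_coe (A p j)
    rw [mul_apply, Finset.sum_congr rfl fun j _ => hscalar j, ← map_sum]
    rfl

/-- The double determinant of `A`, as an element of the base ring. -/
noncomputable def gramDet (A : Matrix (Fin n) (Fin n) ℍ[R,a,b]) : R :=
  mooreDet (A * Aᴴ)

/-- Replacing the `k`-th row of `A` by a left combination of all rows changes the `k`-th row of
`A * Aᴴ` and then its `k`-th column; each change contributes one factor `v k`. -/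
lemma gramDet_updateRow_vecMul (A : Matrix (Fin n) (Fin n) ℍ[R,a,b]) (k : Fin n)
    (v : Fin n → ℍ[R,a,b]) :
    gramDet (A.updateRow k (v ᵥ* A)) = (v k * star (v k)).re * gramDet A := by
  set A' := A.updateRow k (v ᵥ* A) with hA'
  have updateRow_mul (C : Matrix (Fin n) (Fin n) ℍ[R,a,b]) :
      A' * C = (A * C).updateRow k (v ᵥ* (A * C)) := by
    rw [hA', Matrix.updateRow_mul, vecMul_vecMul]
  have hgram := isScalarHermitianOn_mul_conjTranspose A
  have hA'A : A' * Aᴴ = (A * A'ᴴ)ᴴ := by rw [conjTranspose_mul, conjTranspose_conjTranspose]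
  have hcol : IsScalarHermitianOn (A * A'ᴴ) {k}ᶜ := by
    refine (((hgram {k}ᶜ).updateRow (v ᵥ* (A * Aᴴ))).conjTranspose).congr fun p _ q _ => ?_
    rw [← updateRow_mul, conjTranspose_mul, conjTranspose_conjTranspose]
  have hrow : rdet k (A * A'ᴴ) = star (v k * rdet k (A * Aᴴ)) := by
    rw [← hcol.star_rdet_conjTranspose, ← hA'A, updateRow_mul,
      (hgram {k}ᶜ).rdet_updateRow_vecMul]
  refine QuaternionAlgebra.coe_injective (c₁ := a) (c₂ := 0) (c₃ := b) ?_
  rw [gramDet, ← (isScalarHermitianOn_mul_conjTranspose A' _).rdet_eq_mooreDet k, updateRow_mul,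
    hcol.rdet_updateRow_vecMul, hrow, (hgram _).rdet_eq_mooreDet, star_mul,
    QuaternionAlgebra.star_coe, QuaternionAlgebra.coe_commutes, ← mul_assoc,
    QuaternionAlgebra.mul_star_eq_coe, ← QuaternionAlgebra.coe_mul, QuaternionAlgebra.re_coe,
    gramDet]

lemma gramDet_one_add_single_mul (k j : Fin n) (c : ℍ[R,a,b])
    (A : Matrix (Fin n) (Fin n) ℍ[R,a,b]) :
    gramDet ((1 + single k j c) * A) =
      ((1 + single k j c) k k * star ((1 + single k j c) k k)).re * gramDet A := by
  rw [← gramDet_updateRow_vecMul]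
  congr 1
  refine funext fun p => ?_
  by_cases hp : p = k
  · rw [hp, updateRow_self, mul_apply_eq_vecMul]
  · ext1 q
    rw [updateRow_ne hp, add_mul, one_mul, Matrix.add_apply, single_mul_apply_of_ne _ _ _ _ _ hp,
      add_zero]

lemma gramDet_eq_gramDet_conjTranspose {A : Matrix (Fin n) (Fin n) ℍ[R,a,b]}
    (hA : A ∈ elementaryMonoid (Fin n) ℍ[R,a,b]) : gramDet A = gramDet Aᴴ := by
  obtain ⟨c, hc, hc'⟩ : ∃ c : R, (∀ B, gramDet (A * B) = c * gramDet B) ∧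
      ∀ B, gramDet (Aᴴ * B) = c * gramDet B := by
    induction hA using Submonoid.closure_induction with
    | mem E hE =>
      obtain ⟨-, k, j, x, rfl⟩ := hE
      refine ⟨_, gramDet_one_add_single_mul k j x, fun B => ?_⟩
      rw [conjTranspose_add, conjTranspose_one, conjTranspose_single, gramDet_one_add_single_mul]
      have hdiag : (1 + single k j x : Matrix (Fin n) (Fin n) _) j j = (1 + single k j x) k k := by
        by_cases hjk : j = k
        · rw [hjk]
        · simp [hjk, Ne.symm hjk]
      have hstar : (1 + single j k (star x) : Matrix (Fin n) (Fin n) _) j j =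
          star ((1 + single k j x) k k) := by
        rw [← hdiag, ← conjTranspose_apply, conjTranspose_add, conjTranspose_one,
          conjTranspose_single]
      rw [hstar, star_star, re_mul_comm]
    | one => exact ⟨1, by simp, by simp⟩
    | mul A B _ _ ihA ihB =>
      obtain ⟨c, hc, hc'⟩ := ihA
      obtain ⟨d, hd, hd'⟩ := ihB
      refine ⟨c * d, fun M => ?_, fun M => ?_⟩
      · rw [mul_assoc, hc, hd, mul_assoc]
      · rw [conjTranspose_mul, mul_assoc, hd', hc', mul_left_comm, mul_assoc]
  rw [← mul_one A, hc, ← hc', mul_one, mul_one]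

end GramDeterminant

section Cofactor

variable {n : ℕ}

lemma rightDoubleCofactor_eq {S : Type*} [Ring S] [StarRing S] (A : Matrix (Fin n) (Fin n) S)
    (i j : Fin n) : rightDoubleCofactor A i j = (Aᴴ * rowAdjugate (A * Aᴴ)) j i :=
  rdet_updateRow _ i _

lemma leftDoubleCofactor_eq {S : Type*} [Ring S] [StarRing S] (A : Matrix (Fin n) (Fin n) S)
    (i j : Fin n) : leftDoubleCofactor A i j = ((rowAdjugate (Aᴴ * A))ᴴ * Aᴴ) j i := by
  have hupdate : ((Aᴴ * A).updateCol j fun k => Aᴴ k i)ᴴ = (Aᴴ * A).updateRow j (A i) := by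
    rw [← updateRow_conjTranspose, conjTranspose_mul, conjTranspose_conjTranspose]
    congr 1
    ext1 k
    rw [Pi.star_apply, conjTranspose_apply, star_star]
  rw [leftDoubleCofactor, cdet_eq_star_rdet, hupdate, rdet_updateRow, ← conjTranspose_mul,
    conjTranspose_apply, mul_apply_eq_vecMul]

lemma conjTranspose_smul_one {m R : Type*} [DecidableEq m] [CommRing R] {a b : R} (r : R) :
    (r • 1 : Matrix m m ℍ[R,a,b])ᴴ = r • 1 := by
  refine ext fun p q => ?_
  rw [conjTranspose_apply, Matrix.smul_apply, Matrix.smul_apply, QuaternionAlgebra.star_smul',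
    ← conjTranspose_apply, conjTranspose_one]

/-- Both double cofactor matrices are `ddet A` times the inverse of `A`. -/
lemma leftDoubleCofactor_eq_rightDoubleCofactor_of_mem_elementaryMonoid
    {R : Type*} [CommRing R] {a b : R}
    {A : Matrix (Fin n) (Fin n) ℍ[R,a,b]} (hA : A ∈ elementaryMonoid (Fin n) ℍ[R,a,b])
    (i j : Fin n) : leftDoubleCofactor A i j = rightDoubleCofactor A i j := by
  have hleft : (rowAdjugate (Aᴴ * A))ᴴ * Aᴴ * A = gramDet A • 1 := by
    have hgram := (isScalarHermitianOn_mul_conjTranspose Aᴴ Set.univ).mul_rowAdjugate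
    rw [conjTranspose_conjTranspose] at hgram
    have hstar := congrArg conjTranspose hgram
    rw [conjTranspose_mul, conjTranspose_mul, conjTranspose_conjTranspose, ← mul_assoc] at hstar
    rw [hstar, gramDet_eq_gramDet_conjTranspose hA, gramDet, conjTranspose_conjTranspose,
      conjTranspose_smul_one]
  have hright : A * (Aᴴ * rowAdjugate (A * Aᴴ)) = gramDet A • 1 := by
    rw [← mul_assoc, (isScalarHermitianOn_mul_conjTranspose A Set.univ).mul_rowAdjugate, gramDet]
  have hcancel : (rowAdjugate (Aᴴ * A))ᴴ * Aᴴ = Aᴴ * rowAdjugate (A * Aᴴ) := by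
    obtain ⟨u, rfl⟩ := isUnit_of_mem_elementaryMonoid hA
    rw [← u.mul_left_inj, hleft, ← u.mul_right_inj, ← mul_assoc, hright, mul_smul_comm, mul_one,
      smul_mul_assoc, one_mul]
  rw [leftDoubleCofactor_eq, rightDoubleCofactor_eq, hcancel]

end Cofactor

section BaseChange

variable {n : ℕ}

lemma rdet_map {S T : Type*} [Ring S] [Ring T] (f : S →+* T) (i : Fin n)
    (A : Matrix (Fin n) (Fin n) S) : rdet i (A.map f) = f (rdet i A) := by
  have hcycle (σ : Perm (Fin n)) : cycleProd (A.map f) σ = fun x => f (cycleProd A σ x) :=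
    funext (map_cycleProd A σ · f)
  simp only [rdet, hcycle, map_sum, map_zsmul, map_mul, map_list_prod, List.map_map,
    Function.comp_def]

lemma rightDoubleCofactor_map {S T : Type*} [Ring S] [StarRing S] [Ring T] [StarRing T]
    (f : S →+* T) (hf : Function.Semiconj f star star) (A : Matrix (Fin n) (Fin n) S)
    (i j : Fin n) : rightDoubleCofactor (A.map f) i j = f (rightDoubleCofactor A i j) := by
  rw [rightDoubleCofactor, rightDoubleCofactor, ← rdet_map, ← conjTranspose_map f hf,
    map_updateRow, Matrix.map_mul]
  rfl

lemma leftDoubleCofactor_map {S T : Type*} [Ring S] [StarRing S] [Ring T] [StarRing T]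
    (f : S →+* T) (hf : Function.Semiconj f star star) (A : Matrix (Fin n) (Fin n) S)
    (i j : Fin n) : leftDoubleCofactor (A.map f) i j = f (leftDoubleCofactor A i j) := by
  have hupdate : ((A.map f)ᴴ * A.map f).updateCol j (fun k => (A.map f)ᴴ k i) =
      ((Aᴴ * A).updateCol j fun k => Aᴴ k i).map f := by
    rw [map_updateCol, Matrix.map_mul, ← conjTranspose_map f hf]
    rfl
  rw [leftDoubleCofactor, leftDoubleCofactor, cdet_eq_star_rdet, cdet_eq_star_rdet, hf, ← rdet_map,
    hupdate, conjTranspose_map f hf]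

variable {R T : Type*} [CommRing R] [CommRing T] {a b : R} {c d : T}

/-- The ring homomorphism of quaternion algebras induced coefficientwise by a ring homomorphism
of the base rings that respects the structure constants. -/
def quaternionMap (f : R →+* T) (hac : f a = c := by simp) (hbd : f b = d := by simp) :
    ℍ[R,a,b] →+* ℍ[T,c,d] where
  toFun x := ⟨f x.re, f x.imI, f x.imJ, f x.imK⟩
  map_one' := by ext <;> simp
  map_zero' := by ext <;> simp
  map_add' _ _ := by ext <;> simp
  map_mul' _ _ := by subst hac hbd; ext <;> simp

lemma semiconj_quaternionMap_star (f : R →+* T) (hac : f a = c) (hbd : f b = d) :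
    Function.Semiconj (quaternionMap f hac hbd) star star := fun x => by
  ext <;> simp [quaternionMap]

lemma quaternionMap_injective {f : R →+* T} (hf : Function.Injective f) (hac : f a = c)
    (hbd : f b = d) : Function.Injective (quaternionMap f hac hbd) := fun x y hxy => by
  obtain ⟨hre, hI, hJ, hK⟩ := QuaternionAlgebra.ext_iff.1 hxy
  exact QuaternionAlgebra.ext (hf hre) (hf hI) (hf hJ) (hf hK)

lemma isUnit_iff_isUnit_re_mul_star {x : ℍ[R,a,b]} : IsUnit x ↔ IsUnit (x * star x).re := by
  constructor
  · intro hx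
    obtain ⟨y, hy⟩ := (hx.mul hx.star).exists_right_inv
    rw [QuaternionAlgebra.mul_star_eq_coe] at hy
    refine .of_mul_eq_one y.re ?_
    simpa using congrArg QuaternionAlgebra.re hy
  · intro hx
    have hunit : IsUnit (x * star x) := by
      rw [QuaternionAlgebra.mul_star_eq_coe]
      exact hx.map (algebraMap R ℍ[R,a,b])
    exact ((star_comm_self (x := x)).symm.isUnit_mul_iff.1 hunit).1

instance isLocalHom_quaternionMap (f : R →+* T) [IsLocalHom f] (hac : f a = c) (hbd : f b = d) :
    IsLocalHom (quaternionMap f hac hbd) where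
  map_nonunit x hx := by
    rw [isUnit_iff_isUnit_re_mul_star] at hx ⊢
    rw [← semiconj_quaternionMap_star, ← map_mul] at hx
    exact isUnit_of_map_unit f _ hx

end BaseChange

section Pencil

open Polynomial

variable {R : Type*} [CommRing R] {a b : R} {n : ℕ}

/-- The linear pencil through the identity matrix (at `X = 0`) and `A` (at `X = 1`). -/
noncomputable def pencil (A : Matrix (Fin n) (Fin n) ℍ[R,a,b]) :
    Matrix (Fin n) (Fin n) ℍ[R[X],C a,C b] :=
  (1 - X : R[X]) • 1 + (X : R[X]) • A.map (quaternionMap C)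

lemma pencil_map_evalRingHom_one (A : Matrix (Fin n) (Fin n) ℍ[R,a,b]) :
    (pencil A).map (quaternionMap (evalRingHom 1)) = A := by
  ext p q <;> simp [pencil, quaternionMap]

lemma pencil_map_coe_mem_elementaryMonoid (A : Matrix (Fin n) (Fin n) ℍ[R,a,b]) :
    (pencil A).map (quaternionMap coeToPowerSeries.ringHom) ∈
      elementaryMonoid (Fin n) ℍ[PowerSeries R,PowerSeries.C a,PowerSeries.C b] := by
  have : IsLocalHom (PowerSeries.constantCoeff (R := R)) :=
    ⟨fun _ => PowerSeries.isUnit_iff_constantCoeff.2⟩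
  refine mem_elementaryMonoid_of_map_eq_one
    (quaternionMap PowerSeries.constantCoeff (c := a) (d := b)) ?_
  ext p q <;> by_cases hpq : p = q <;> simp [pencil, quaternionMap, one_apply, hpq]

end Pencil

end DoubleCofactor

open DoubleCofactor in
theorem mainTheorem7_general {R : Type*} [CommRing R] (a b : R) (n : ℕ)
    (A : Matrix (Fin n) (Fin n) ℍ[R,a,b]) (i j : Fin n) :
    Matrix.leftDoubleCofactor A i j = Matrix.rightDoubleCofactor A i j := by
  have hpencil : Matrix.leftDoubleCofactor (pencil A) i j =
      Matrix.rightDoubleCofactor (pencil A) i j := by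
    refine quaternionMap_injective (c := PowerSeries.C a) (d := PowerSeries.C b)
      (f := Polynomial.coeToPowerSeries.ringHom) (Polynomial.coe_injective R)
      (by simp) (by simp) ?_
    rw [← leftDoubleCofactor_map _ (semiconj_quaternionMap_star _ _ _),
      ← rightDoubleCofactor_map _ (semiconj_quaternionMap_star _ _ _)]
    exact leftDoubleCofactor_eq_rightDoubleCofactor_of_mem_elementaryMonoid
      (pencil_map_coe_mem_elementaryMonoid A) i j
  nth_rw 1 2 [← pencil_map_evalRingHom_one A]
  rw [leftDoubleCofactor_map _ (semiconj_quaternionMap_star _ _ _),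
    rightDoubleCofactor_map _ (semiconj_quaternionMap_star _ _ _), hpencil]

theorem mainTheorem7 {F : Type*} [Field F] (a b : F) (n : ℕ) [NeZero n]
    (A : Matrix (Fin n) (Fin n) ℍ[F, a, b]) (hA : Matrix.ddet A ≠ 0) :
    ∀ i j : Fin n, Matrix.leftDoubleCofactor A i j = Matrix.rightDoubleCofactor A i j :=
  mainTheorem7_general a b n A
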